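/- Let $\Pi=[\pi_{ij}]_{i,j\in\{0,1\}}$ be a $2\times 2$ stochastic matrix with all $\pi_{ij}>0$ and $\det(\Pi)>0$, and let $0<\varepsilon\le 1/2$. Let $Y$ be the stationary Markov chain on $\{0,1\}$ with transition matrix $\Pi$, let $E$ be an i.i.d. sequence of bits independent of $Y$ with $p_E(1)=\varepsilon$ and $p_E(0)=1-\varepsilon$, and let $Z_i=Y_i+E_i \pmod 2$. For an observed word $z_1\cdots z_n$ put $$x_n=\frac{p(z_1,\dots,z_n,\,y_n=0)}{p(z_1,\dots,z_n,\,y_n=1)};$$ thus $x_0=\pi_{10}/\pi_{01}$ and $x_{n+1}=f_{z_{n+1}}(x_n)$, where, with $\bar z=1-z$, $$f_z(x)=\frac{p_E(z)}{p_E(\bar z)}\cdot\frac{\pi_{00}x+\pi_{10}}{\pi_{01}x+\pi_{11}},\qquad z\in\{0,1\}.$$ Then, as $n\to\infty$, the distribution of $x_n$ (under the law of $Z_1,\dots,Z_n$) converges weakly to a probability measure $Q$ on $\mathbb R$; $f_0$ and $f_1$ have unique positive fixed points $p_0$ and $p_1$ respectively; and $p_1\le p_0$. Let $I=[p_1,p_0]$,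 and let $\mathrm{supp}(Q)$ be the smallest closed set of $Q$-measure one. Then $\mathrm{supp}(Q)$ is either a Cantor set (a set homeomorphic to the middle-thirds Cantor set) or a closed interval (possibly consisting of a single point). Specifically: 1. $\mathrm{supp}(Q)$ is a Cantor set if $f_0(I)\cup f_1(I)\subsetneqq I$. 2. $\mathrm{supp}(Q)=I$ if $f_0(I)\cup f_1(I)=I$. -/

import Mathlib

open MeasureTheory Filter Topology
open scoped NNReal

namespace NoisyMarkov

/-- Stationary distribution of the two-state Markov chain with transition matrix `P`. -/
noncomputable def stationary (P : Matrix (Fin 2) (Fin 2) ℝ) : Fin 2 → ℝ :=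
  ![P 1 0 / (P 0 1 + P 1 0), P 0 1 / (P 0 1 + P 1 0)]

/-- Distribution of one noise bit of the binary symmetric channel with crossover
probability `ε`: the bit is `1` with probability `ε` and `0` with probability `1 - ε`. -/
def noise (ε : ℝ) : Fin 2 → ℝ := ![1 - ε, ε]

/-- Probability that the stationary chain runs through the hidden states `y 0, …, y n` and that
the independent noise bits at the times `1, …, n` are `e 0, …, e (n - 1)`. -/
noncomputable def pathProb (P : Matrix (Fin 2) (Fin 2) ℝ) (ε : ℝ) (n : ℕ)
    (y : Fin (n + 1) → Fin 2) (e : Fin n → Fin 2) : ℝ :=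
  stationary P (y 0) * ∏ i : Fin n, (P (y i.castSucc) (y i.succ) * noise ε (e i))

/-- The joint probability `p(z_1, …, z_n, y_n = j)`: the hidden chain is in state `j` at time `n`
and the observed symbols `z_i = y_i + e_i` (addition modulo `2`) at the times `1, …, n` are the
letters of the word `z`. -/
noncomputable def jointProb (P : Matrix (Fin 2) (Fin 2) ℝ) (ε : ℝ) (n : ℕ)
    (z : Fin n → Fin 2) (j : Fin 2) : ℝ :=
  ∑ y : Fin (n + 1) → Fin 2, ∑ e : Fin n → Fin 2,
    if (∀ i : Fin n, z i = y i.succ + e i) ∧ y (Fin.last n) = j then pathProb P ε n y e else 0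

/-- The probability `p(z_1, …, z_n)` of an observed word. -/
noncomputable def wordProb (P : Matrix (Fin 2) (Fin 2) ℝ) (ε : ℝ) (n : ℕ)
    (z : Fin n → Fin 2) : ℝ :=
  ∑ j : Fin 2, jointProb P ε n z j

/-- The value `x_n = p(z_1, …, z_n, y_n = 0) / p(z_1, …, z_n, y_n = 1)` on an observed word. -/
noncomputable def ratio (P : Matrix (Fin 2) (Fin 2) ℝ) (ε : ℝ) (n : ℕ)
    (z : Fin n → Fin 2) : ℝ :=
  jointProb P ε n z 0 / jointProb P ε n z 1

/-- The distribution of the random variable `x_n` on the real line. -/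
noncomputable def ratioLaw (P : Matrix (Fin 2) (Fin 2) ℝ) (ε : ℝ) (n : ℕ) : FiniteMeasure ℝ :=
  ∑ z : Fin n → Fin 2,
    (wordProb P ε n z).toNNReal • (ProbabilityMeasure.toFiniteMeasure
      ⟨Measure.dirac (ratio P ε n z), Measure.dirac.isProbabilityMeasure⟩)

/-- The maps `f_0, f_1` of the random dynamical system `x_{n+1} = f_{z_{n+1}}(x_n)`. -/
noncomputable def f (P : Matrix (Fin 2) (Fin 2) ℝ) (ε : ℝ) (z : Fin 2) (x : ℝ) : ℝ :=
  noise ε z / noise ε (z + 1) * ((P 0 0 * x + P 1 0) / (P 0 1 * x + P 1 1))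

/-- `p` is the unique positive fixed point of `g`. -/
def IsUniquePosFixedPoint (g : ℝ → ℝ) (p : ℝ) : Prop :=
  (0 < p ∧ g p = p) ∧ ∀ x : ℝ, 0 < x → g x = x → x = p

/-- A Cantor set: a set homeomorphic to the middle-thirds Cantor set. -/
def IsCantorSet (S : Set ℝ) : Prop := Nonempty (S ≃ₜ cantorSet)

end NoisyMarkov

namespace NoisyMarkov

/-! Words grow at two ends. Appending a letter `a` applies `f a` to the ratio (`ratio_snoc`), while
summing over a prepended letter leaves word probabilities unchanged, by stationarity
(`sum_jointProb_cons`). The increasing Möbius maps `f 0`, `f 1` send `[p₁, p₀]` into itself and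
contract relative distances by a factor `τ < 1` (`exists_isContractingPair`). Hence a word and its
one-letter extension to the left have ratios within `O(τ ^ n)`, so integrals of Lipschitz functions
are Cauchy; as everything lives on a compact interval, the laws converge weakly.

The support of the limit is the attractor of the pair, that is, the range of the map sending an
address `s` to `lim f (s 0) ∘ ⋯ ∘ f (s (n - 1))`. Nothing outside the attractor is charged, because
long words have ratios in deep levels; each cylinder of depth `n` is charged, because any prescribed
last `n` letters have probability at least `ε ^ n` (`support_eq_range`). If the two images cover the
interval, the attractor is the interval. Otherwise they are disjoint, addresses are unique, and the
attractor is a copy of `{0,1}^ℕ`. -/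

/-! ### Word probabilities: forward recursion and stationarity. -/

theorem sum_snoc {n : ℕ} {M : Type*} [AddCommMonoid M] (F : (Fin (n + 1) → Fin 2) → M) :
    ∑ y, F y = ∑ i : Fin 2, ∑ y : Fin n → Fin 2, F (Fin.snoc y i) := by
  rw [← (Fin.snocEquiv fun _ : Fin (n + 1) => Fin 2).sum_comp, Fintype.sum_prod_type]
  rfl

theorem sum_cons {n : ℕ} {M : Type*} [AddCommMonoid M] (F : (Fin (n + 1) → Fin 2) → M) :
    ∑ y, F y = ∑ i : Fin 2, ∑ y : Fin n → Fin 2, F (Fin.cons i y) := by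
  rw [← (Fin.consEquiv fun _ : Fin (n + 1) => Fin 2).sum_comp, Fintype.sum_prod_type]
  rfl

theorem last_cons {n : ℕ} (a : Fin 2) (z : Fin (n + 1) → Fin 2) :
    (Fin.cons a z : Fin (n + 2) → Fin 2) (Fin.last (n + 1)) = z (Fin.last n) := by
  rw [← Fin.succ_last, Fin.cons_succ]

theorem init_cons {n : ℕ} (a : Fin 2) (z : Fin (n + 1) → Fin 2) :
    Fin.init (Fin.cons a z : Fin (n + 2) → Fin 2) = Fin.cons a (Fin.init z) := by
  conv_lhs => rw [← Fin.snoc_init_self z, Fin.cons_snoc_eq_snoc_cons]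
  exact Fin.init_snoc (α := fun _ => Fin 2) _ _

theorem pathProb_snoc (P : Matrix (Fin 2) (Fin 2) ℝ) (ε : ℝ) (n : ℕ)
    (y : Fin (n + 1) → Fin 2) (e : Fin n → Fin 2) (i b : Fin 2) :
    pathProb P ε (n + 1) (Fin.snoc y i) (Fin.snoc e b) =
      pathProb P ε n y e * (P (y (Fin.last n)) i * noise ε b) := by
  have h0 : (Fin.snoc y i : Fin (n + 2) → Fin 2) 0 = y 0 := by
    rw [← Fin.castSucc_zero, Fin.snoc_castSucc (α := fun _ => Fin 2)]
  simp only [pathProb, Fin.prod_univ_castSucc, Fin.succ_castSucc, Fin.succ_last,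
    Fin.snoc_castSucc (α := fun _ => Fin 2), Fin.snoc_last (α := fun _ => Fin 2), h0]
  ring

theorem jointProb_zero (P : Matrix (Fin 2) (Fin 2) ℝ) (ε : ℝ) (z : Fin 0 → Fin 2) (j : Fin 2) :
    jointProb P ε 0 z j = stationary P j := by
  rw [jointProb, sum_snoc, Finset.sum_eq_single j]
  · simp [pathProb, Fin.snoc]
  · intro i _ hi
    simp [Fin.snoc, hi]
  · simp

/-- Given the hidden state `i` at time `n`, the next hidden state and noise bit are independent of
the past; the letter `a` and the new state `j` force the noise bit to be `a + j`. -/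
theorem jointProb_snoc (P : Matrix (Fin 2) (Fin 2) ℝ) (ε : ℝ) (n : ℕ) (z : Fin n → Fin 2)
    (a j : Fin 2) :
    jointProb P ε (n + 1) (Fin.snoc z a) j =
      noise ε (a + j) * ∑ i, jointProb P ε n z i * P i j := by
  have hb : ∀ k b : Fin 2, (a = k + b) ↔ b = a + k := by
    revert a; decide
  -- The constraints at the last time separate from the earlier ones, so all sums over last
  -- coordinates collapse.
  have key : ∀ (k : Fin 2) (y : Fin (n + 1) → Fin 2) (b : Fin 2) (e : Fin n → Fin 2),
      (if (∀ i : Fin (n + 1), (Fin.snoc z a : Fin (n + 1) → Fin 2) i =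
            (Fin.snoc y k : Fin (n + 2) → Fin 2) i.succ + (Fin.snoc e b : Fin (n + 1) → Fin 2) i) ∧
          (Fin.snoc y k : Fin (n + 2) → Fin 2) (Fin.last (n + 1)) = j then
        pathProb P ε (n + 1) (Fin.snoc y k) (Fin.snoc e b) else 0) =
      if k = j then if b = a + k then if ∀ i : Fin n, z i = y i.succ + e i then
        pathProb P ε n y e * (P (y (Fin.last n)) k * noise ε b) else 0 else 0 else 0 := by
    intro k y b e
    rw [pathProb_snoc]
    simp only [Fin.forall_fin_succ', Fin.succ_castSucc, Fin.succ_last,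
      Fin.snoc_castSucc (α := fun _ => Fin 2), Fin.snoc_last (α := fun _ => Fin 2), hb]
    split_ifs <;> tauto
  rw [jointProb, sum_snoc]
  refine (Finset.sum_congr rfl fun k _ => Finset.sum_congr rfl fun y _ => (sum_snoc _).trans
    (Finset.sum_congr rfl fun b _ => Finset.sum_congr rfl fun e _ => key k y b e)).trans ?_
  rw [Finset.sum_eq_single j (by intro k _ hk; simp [hk]) (by simp)]
  simp only [if_true, jointProb, Finset.sum_mul, Finset.mul_sum]
  refine Eq.trans ?_ Finset.sum_comm
  refine Finset.sum_congr rfl fun y _ => ?_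
  rw [Finset.sum_eq_single (a + j) (by intro k _ hk; simp [hk]) (by simp), Finset.sum_comm]
  refine Finset.sum_congr rfl fun e _ => ?_
  rw [Finset.sum_eq_single (y (Fin.last n)) (by intro k _ hk; simp [hk.symm]) (by simp)]
  simp only [if_true, and_true]
  split_ifs <;> ring

theorem jointProb_succ (P : Matrix (Fin 2) (Fin 2) ℝ) (ε : ℝ) (n : ℕ) (z : Fin (n + 1) → Fin 2)
    (j : Fin 2) :
    jointProb P ε (n + 1) z j =
      noise ε (z (Fin.last n) + j) * ∑ i, jointProb P ε n (Fin.init z) i * P i j := by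
  rw [← jointProb_snoc, Fin.snoc_init_self]

section

variable {P : Matrix (Fin 2) (Fin 2) ℝ} {ε : ℝ}

theorem noise_pos (hε : 0 < ε) (hε' : ε ≤ 1 / 2) (i : Fin 2) : 0 < noise ε i := by
  fin_cases i <;> simp [noise] <;> linarith

theorem le_noise (hε' : ε ≤ 1 / 2) (i : Fin 2) : ε ≤ noise ε i := by
  fin_cases i <;> simp [noise]; linarith

theorem noise_add_noise (ε : ℝ) (j : Fin 2) : ∑ a : Fin 2, noise ε (a + j) = 1 := by
  fin_cases j <;> simp [noise, Fin.sum_univ_two]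

theorem stationary_pos (hpos : ∀ i j, 0 < P i j) (j : Fin 2) : 0 < stationary P j := by
  have h1 := hpos 0 1
  have h2 := hpos 1 0
  fin_cases j <;> simp [stationary] <;> positivity

theorem sum_stationary (hpos : ∀ i j, 0 < P i j) : ∑ j, stationary P j = 1 := by
  have h1 := hpos 0 1
  have h2 := hpos 1 0
  simp only [stationary, Fin.sum_univ_two, Matrix.cons_val_zero, Matrix.cons_val_one]
  field_simp
  ring

theorem stationary_mul (hpos : ∀ i j, 0 < P i j) (hrow : ∀ i, ∑ j, P i j = 1) (j : Fin 2) :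
    ∑ i, stationary P i * P i j = stationary P j := by
  have h1 := hpos 0 1
  have h2 := hpos 1 0
  have r0 := hrow 0
  have r1 := hrow 1
  simp only [Fin.sum_univ_two] at r0 r1
  have e0 : P 0 0 = 1 - P 0 1 := by linarith
  have e1 : P 1 1 = 1 - P 1 0 := by linarith
  fin_cases j <;> simp [stationary, Fin.sum_univ_two, e0, e1] <;> field_simp <;> ring

theorem jointProb_pos (hpos : ∀ i j, 0 < P i j) (hε : 0 < ε) (hε' : ε ≤ 1 / 2) (n : ℕ)
    (z : Fin n → Fin 2) (j : Fin 2) : 0 < jointProb P ε n z j := by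
  induction n generalizing j with
  | zero => rw [jointProb_zero]; exact stationary_pos hpos j
  | succ n ih =>
    rw [jointProb_succ]
    exact mul_pos (noise_pos hε hε' _)
      (Finset.sum_pos (fun i _ => mul_pos (ih _ i) (hpos i j)) Finset.univ_nonempty)

theorem wordProb_pos (hpos : ∀ i j, 0 < P i j) (hε : 0 < ε) (hε' : ε ≤ 1 / 2) (n : ℕ)
    (z : Fin n → Fin 2) : 0 < wordProb P ε n z :=
  Finset.sum_pos (fun j _ => jointProb_pos hpos hε hε' n z j) Finset.univ_nonempty

/-- Stationarity of the observed process: summing over the first letter deletes it. -/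
theorem sum_jointProb_cons (hpos : ∀ i j, 0 < P i j) (hrow : ∀ i, ∑ j, P i j = 1) (n : ℕ)
    (z : Fin n → Fin 2) (j : Fin 2) :
    ∑ a : Fin 2, jointProb P ε (n + 1) (Fin.cons a z) j = jointProb P ε n z j := by
  induction n generalizing j with
  | zero =>
    simp_rw [jointProb_succ, jointProb_zero, stationary_mul hpos hrow]
    rw [← Finset.sum_mul]
    have : ∀ a : Fin 2, (Fin.cons a z : Fin 1 → Fin 2) (Fin.last 0) = a := fun a => rfl
    simp_rw [this, noise_add_noise, one_mul]
  | succ n ih =>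
    simp_rw [jointProb_succ P ε (n + 1), last_cons, init_cons, ← Finset.mul_sum]
    rw [Finset.sum_comm, jointProb_succ]
    simp_rw [← Finset.sum_mul, ih]

theorem sum_wordProb_cons (hpos : ∀ i j, 0 < P i j) (hrow : ∀ i, ∑ j, P i j = 1) (n : ℕ)
    (z : Fin n → Fin 2) :
    ∑ a : Fin 2, wordProb P ε (n + 1) (Fin.cons a z) = wordProb P ε n z := by
  simp_rw [wordProb]
  rw [Finset.sum_comm]
  simp_rw [sum_jointProb_cons hpos hrow]

theorem sum_wordProb (hpos : ∀ i j, 0 < P i j) (hrow : ∀ i, ∑ j, P i j = 1) (n : ℕ) :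
    ∑ z, wordProb P ε n z = 1 := by
  induction n with
  | zero => simp [wordProb, jointProb_zero, -Fin.sum_univ_two, sum_stationary hpos]
  | succ n ih =>
    rw [sum_cons, Finset.sum_comm]
    simp_rw [sum_wordProb_cons hpos hrow, ih]

/-- Both noise values have probability at least `ε`, so every letter has conditional probability at
least `ε` whatever the past. This makes all cylinders charged in the limit. -/
theorem mul_wordProb_le (hpos : ∀ i j, 0 < P i j) (hrow : ∀ i, ∑ j, P i j = 1) (hε : 0 < ε)
    (hε' : ε ≤ 1 / 2) (n : ℕ) (z : Fin n → Fin 2) (a : Fin 2) :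
    ε * wordProb P ε n z ≤ wordProb P ε (n + 1) (Fin.snoc z a) := by
  have h : wordProb P ε n z = ∑ j, ∑ i, jointProb P ε n z i * P i j := by
    rw [Finset.sum_comm]
    simp_rw [← Finset.mul_sum, hrow, mul_one]
    rfl
  rw [h, wordProb, Finset.mul_sum]
  refine Finset.sum_le_sum fun j _ => ?_
  rw [jointProb_snoc]
  exact mul_le_mul_of_nonneg_right (le_noise hε' _)
    (Finset.sum_nonneg fun i _ => (mul_pos (jointProb_pos hpos hε hε' n z i) (hpos i j)).le)

theorem ratio_zero (hpos : ∀ i j, 0 < P i j) (z : Fin 0 → Fin 2) :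
    ratio P ε 0 z = P 1 0 / P 0 1 := by
  have h1 := hpos 0 1
  have h2 := hpos 1 0
  simp only [ratio, jointProb_zero, stationary, Matrix.cons_val_zero, Matrix.cons_val_one]
  field_simp

theorem ratio_snoc (hpos : ∀ i j, 0 < P i j) (hε : 0 < ε) (hε' : ε ≤ 1 / 2) (n : ℕ)
    (z : Fin n → Fin 2) (a : Fin 2) :
    ratio P ε (n + 1) (Fin.snoc z a) = f P ε a (ratio P ε n z) := by
  have h0 := jointProb_pos hpos hε hε' n z 0
  have h1 := jointProb_pos hpos hε hε' n z 1
  have p01 := hpos 0 1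
  have p11 := hpos 1 1
  have n1 := noise_pos hε hε' (a + 1)
  simp only [ratio, f, jointProb_snoc, Fin.sum_univ_two, add_zero]
  have : 0 < P 0 1 * (jointProb P ε n z 0 / jointProb P ε n z 1) + P 1 1 := by positivity
  have : 0 < jointProb P ε n z 0 * P 0 1 + jointProb P ε n z 1 * P 1 1 := by positivity
  rw [div_mul_div_comm, div_eq_div_iff (by positivity) (by positivity)]
  field_simp

end

/-! ### Attractor and coding map of a contracting pair. -/

/-- Two increasing self-maps of `[a, b]`, the first one fixing `b` and the second one fixing `a`,
both contracting by the factor `τ` the relative distance `(y - x) / x` of points `x ≤ y`. -/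
structure IsContractingPair (g : Fin 2 → ℝ → ℝ) (a b τ : ℝ) : Prop where
  pos : 0 < a
  le : a ≤ b
  cont : ∀ i, ContinuousOn (g i) (Set.Icc a b)
  mono : ∀ i, StrictMonoOn (g i) (Set.Icc a b)
  maps : ∀ i, Set.MapsTo (g i) (Set.Icc a b) (Set.Icc a b)
  fix_right : g 0 b = b
  fix_left : g 1 a = a
  nonneg : 0 ≤ τ
  lt_one : τ < 1
  contr : ∀ i D x y, x ∈ Set.Icc a b → y ∈ Set.Icc a b → x ≤ y → y - x ≤ D * x →
    g i y - g i x ≤ τ * D * g i x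

/-- The composition `g (s 0) ∘ ⋯ ∘ g (s (n - 1))`. -/
def compose (g : Fin 2 → ℝ → ℝ) : ℕ → (ℕ → Fin 2) → ℝ → ℝ
  | 0, _, x => x
  | n + 1, s, x => g (s 0) (compose g n (fun k => s (k + 1)) x)

/-- The definition peels off the outermost map; peeling off the innermost shows that lengthening an
address only changes the argument of the same composition. -/
theorem compose_succ' (g : Fin 2 → ℝ → ℝ) (n : ℕ) (s : ℕ → Fin 2) (x : ℝ) :
    compose g (n + 1) s x = compose g n s (g (s n) x) := by
  induction n generalizing s with
  | zero => rfl
  | succ n ih => rw [compose, ih]; rfl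

theorem compose_congr (g : Fin 2 → ℝ → ℝ) (n : ℕ) {s t : ℕ → Fin 2} (h : ∀ k < n, s k = t k)
    (x : ℝ) : compose g n s x = compose g n t x := by
  induction n generalizing s t with
  | zero => rfl
  | succ n ih =>
    rw [compose, compose, h 0 n.succ_pos,
      ih (s := fun k => s (k + 1)) (t := fun k => t (k + 1)) fun k hk => h _ (by omega)]

/-- The set of the values on `[a, b]` of all compositions of `m` maps. -/
def level (g : Fin 2 → ℝ → ℝ) (a b : ℝ) : ℕ → Set ℝ
  | 0 => Set.Icc a b
  | m + 1 => g 0 '' level g a b m ∪ g 1 '' level g a b m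

theorem exists_compose_of_mem_level {g : Fin 2 → ℝ → ℝ} {a b : ℝ} {m : ℕ} {x : ℝ}
    (hx : x ∈ level g a b m) : ∃ s, ∃ y ∈ Set.Icc a b, compose g m s y = x := by
  induction m generalizing x with
  | zero => exact ⟨fun _ => 0, x, hx, rfl⟩
  | succ m ih =>
    have : ∃ i, ∃ y ∈ level g a b m, g i y = x := by
      rcases hx with ⟨y, hy, h⟩ | ⟨y, hy, h⟩
      exacts [⟨0, y, hy, h⟩, ⟨1, y, hy, h⟩]
    obtain ⟨i, y, hy, rfl⟩ := this
    obtain ⟨s, w, hw, rfl⟩ := ih hy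
    exact ⟨fun k => Nat.casesOn k i s, w, hw, rfl⟩

namespace IsContractingPair

variable {g : Fin 2 → ℝ → ℝ} {a b τ : ℝ}

theorem left_mem (h : IsContractingPair g a b τ) : a ∈ Set.Icc a b := ⟨le_rfl, h.le⟩

theorem right_mem (h : IsContractingPair g a b τ) : b ∈ Set.Icc a b := ⟨h.le, le_rfl⟩

theorem compose_mem (h : IsContractingPair g a b τ) (n : ℕ) (s : ℕ → Fin 2) {x : ℝ}
    (hx : x ∈ Set.Icc a b) : compose g n s x ∈ Set.Icc a b := by
  induction n generalizing s with
  | zero => exact hx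
  | succ n ih => exact h.maps _ (ih _)

/-- The bound for the length of the image of `[a, b]` under a composition of `n` maps. -/
theorem dist_le_of_le (h : IsContractingPair g a b τ) (n : ℕ) {x y : ℝ}
    (hx : x ∈ Set.Icc a b) (hxy : x ≤ y) (hD : y - x ≤ τ ^ n * ((b - a) / a) * x) :
    |y - x| ≤ (b - a) / a * b * τ ^ n := by
  rw [abs_of_nonneg (sub_nonneg.2 hxy)]
  have h1 : 0 ≤ (b - a) / a := div_nonneg (sub_nonneg.2 h.le) h.pos.le
  have h2 : 0 ≤ τ ^ n := pow_nonneg h.nonneg n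
  calc y - x ≤ τ ^ n * ((b - a) / a) * x := hD
    _ ≤ τ ^ n * ((b - a) / a) * b := by gcongr; exact hx.2
    _ = _ := by ring

theorem sub_le (h : IsContractingPair g a b τ) {x y : ℝ}
    (hx : x ∈ Set.Icc a b) (hy : y ∈ Set.Icc a b) : y - x ≤ (b - a) / a * x := by
  have ha := h.pos
  have h1 : 0 ≤ (b - a) / a := div_nonneg (sub_nonneg.2 h.le) h.pos.le
  calc y - x ≤ (b - a) / a * a := by
        rw [div_mul_cancel₀ _ ha.ne']; linarith [hx.1, hy.2]
    _ ≤ _ := by gcongr; exact hx.1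

/-- The relative distance starts at no more than `(b - a) / a` and is multiplied by at most `τ` at
each map; the lower point never exceeds `b`, which converts it into an absolute distance. -/
theorem abs_compose_sub_le (h : IsContractingPair g a b τ) (n : ℕ) (s : ℕ → Fin 2) {x y : ℝ}
    (hx : x ∈ Set.Icc a b) (hy : y ∈ Set.Icc a b) :
    |compose g n s x - compose g n s y| ≤ (b - a) / a * b * τ ^ n := by
  wlog hxy : x ≤ y generalizing x y
  · rw [abs_sub_comm]; exact this hy hx (le_of_not_ge hxy)
  -- The order is carried through the induction because the contraction applies to ordered pairs
  -- only.
  have key : compose g n s x ≤ compose g n s y ∧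
      compose g n s y - compose g n s x ≤ τ ^ n * ((b - a) / a) * compose g n s x := by
    induction n generalizing s with
    | zero => simpa [compose] using ⟨hxy, by linarith [h.sub_le hx hy]⟩
    | succ n ih =>
      obtain ⟨h1, h2⟩ := ih fun k => s (k + 1)
      refine ⟨(h.mono _).monotoneOn (h.compose_mem _ _ hx) (h.compose_mem _ _ hy) h1, ?_⟩
      have := h.contr (s 0) _ _ _ (h.compose_mem _ _ hx) (h.compose_mem _ _ hy) h1 h2
      rw [pow_succ', mul_assoc τ]
      exact this
  rw [abs_sub_comm]
  exact h.dist_le_of_le n (h.compose_mem _ _ hx) key.1 key.2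

theorem tendsto_bound (h : IsContractingPair g a b τ) :
    Tendsto (fun n : ℕ => (b - a) / a * b * τ ^ n) atTop (𝓝 0) := by
  simpa using (tendsto_pow_atTop_nhds_zero_of_lt_one h.nonneg h.lt_one).const_mul ((b - a) / a * b)

theorem exists_coding (h : IsContractingPair g a b τ) :
    ∃ c : (ℕ → Fin 2) → ℝ, ∀ s, Tendsto (fun n => compose g n s a) atTop (𝓝 (c s)) := by
  have : ∀ s, ∃ l, Tendsto (fun n => compose g n s a) atTop (𝓝 l) := fun s => by
    refine cauchySeq_tendsto_of_complete
      (cauchySeq_of_le_geometric τ ((b - a) / a * b) h.lt_one fun n => ?_)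
    rw [Real.dist_eq, compose_succ']
    exact h.abs_compose_sub_le n s h.left_mem (h.maps _ h.left_mem)
  exact ⟨fun s => (this s).choose, fun s => (this s).choose_spec⟩

/-- The coding map: the point of `[a, b]` with a given address. -/
noncomputable def coding (h : IsContractingPair g a b τ) : (ℕ → Fin 2) → ℝ := h.exists_coding.choose

theorem tendsto_coding (h : IsContractingPair g a b τ) (s : ℕ → Fin 2) :
    Tendsto (fun n => compose g n s a) atTop (𝓝 (h.coding s)) := h.exists_coding.choose_spec s

theorem coding_mem (h : IsContractingPair g a b τ) (s : ℕ → Fin 2) : h.coding s ∈ Set.Icc a b :=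
  isClosed_Icc.mem_of_tendsto (h.tendsto_coding s)
    (Eventually.of_forall fun n => h.compose_mem n s h.left_mem)

theorem coding_eq (h : IsContractingPair g a b τ) (s : ℕ → Fin 2) :
    h.coding s = g (s 0) (h.coding fun k => s (k + 1)) := by
  refine tendsto_nhds_unique ((h.tendsto_coding s).comp (tendsto_add_atTop_nat 1)) ?_
  have h1 := h.tendsto_coding fun k => s (k + 1)
  have h2 : Tendsto (fun n => compose g n (fun k => s (k + 1)) a) atTop
      (𝓝[Set.Icc a b] (h.coding fun k => s (k + 1))) :=
    tendsto_nhdsWithin_iff.2 ⟨h1, Eventually.of_forall fun n => h.compose_mem n _ h.left_mem⟩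
  exact (h.cont (s 0) _ (h.coding_mem _)).tendsto.comp h2

theorem coding_eq_compose (h : IsContractingPair g a b τ) (n : ℕ) (s : ℕ → Fin 2) :
    h.coding s = compose g n s (h.coding fun k => s (k + n)) := by
  induction n generalizing s with
  | zero => rfl
  | succ n ih =>
    rw [coding_eq, ih, compose]
    simp only [add_assoc]

theorem abs_compose_sub_coding_le (h : IsContractingPair g a b τ) (n : ℕ) (s : ℕ → Fin 2) {x : ℝ}
    (hx : x ∈ Set.Icc a b) :
    |compose g n s x - h.coding s| ≤ (b - a) / a * b * τ ^ n := by
  rw [h.coding_eq_compose n s]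
  exact h.abs_compose_sub_le n s hx (h.coding_mem _)

theorem continuous_coding (h : IsContractingPair g a b τ) : Continuous h.coding := by
  rw [continuous_iff_continuousAt]
  intro s
  rw [ContinuousAt, Metric.tendsto_nhds]
  intro δ hδ
  obtain ⟨n, hn⟩ := (h.tendsto_bound.eventually_lt_const hδ).exists
  have : ∀ᶠ t in 𝓝 s, ∀ k ∈ Finset.range n, t k = s k := by
    rw [eventually_all_finset]
    intro k _
    have := (continuous_apply (A := fun _ : ℕ => Fin 2) k).continuousAt (x := s)
    exact this.eventually (eventually_of_mem ((isOpen_discrete {s k}).mem_nhds rfl) fun _ h => h)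
  filter_upwards [this] with t ht
  rw [Real.dist_eq, h.coding_eq_compose n t,
    compose_congr g n (t := s) fun k hk => ht k (Finset.mem_range.2 hk)]
  exact (h.abs_compose_sub_coding_le n s (h.coding_mem _)).trans_lt hn

theorem level_subset_and_isCompact (h : IsContractingPair g a b τ) (m : ℕ) :
    level g a b m ⊆ Set.Icc a b ∧ IsCompact (level g a b m) := by
  induction m with
  | zero => exact ⟨subset_rfl, isCompact_Icc⟩
  | succ m ih =>
    refine ⟨Set.union_subset ?_ ?_, .union ?_ ?_⟩
    · exact (Set.image_mono ih.1).trans (h.maps 0).image_subset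
    · exact (Set.image_mono ih.1).trans (h.maps 1).image_subset
    · exact ih.2.image_of_continuousOn ((h.cont 0).mono ih.1)
    · exact ih.2.image_of_continuousOn ((h.cont 1).mono ih.1)

theorem isClosed_range_coding (h : IsContractingPair g a b τ) : IsClosed (Set.range h.coding) :=
  (isCompact_range h.continuous_coding).isClosed

/-- A point of level `n` is a composition along some address `s`, hence close to `h.coding s`; the
range is compact, hence closed. -/
theorem iInter_level_subset (h : IsContractingPair g a b τ) :
    ⋂ m, level g a b m ⊆ Set.range h.coding := by
  intro x hx
  rw [← h.isClosed_range_coding.closure_eq, Metric.mem_closure_iff]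
  intro δ hδ
  obtain ⟨n, hn⟩ := (h.tendsto_bound.eventually_lt_const hδ).exists
  obtain ⟨s, y, hy, rfl⟩ := exists_compose_of_mem_level (Set.mem_iInter.1 hx n)
  exact ⟨_, Set.mem_range_self s, (h.abs_compose_sub_coding_le n s hy).trans_lt hn⟩

theorem continuousOn_compose (h : IsContractingPair g a b τ) (n : ℕ) (s : ℕ → Fin 2) :
    ContinuousOn (compose g n s) (Set.Icc a b) := by
  induction n generalizing s with
  | zero => exact continuousOn_id
  | succ n ih => exact (h.cont (s 0)).comp (ih _) fun x hx => h.compose_mem n _ hx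

/-- Closed levels of full measure confine the support to their intersection, and every neighbourhood
of a coded point contains a whole cylinder image, which has positive measure. -/
theorem support_eq_range (h : IsContractingPair g a b τ) (Q : Measure ℝ)
    (h0 : ∀ m, Q (level g a b m)ᶜ = 0) (h1 : ∀ n s, 0 < Q (compose g n s '' Set.Icc a b)) :
    Q.support = Set.range h.coding := by
  refine Set.Subset.antisymm (Set.Subset.trans (Set.subset_iInter fun m => ?_)
    h.iInter_level_subset) ?_
  · exact Measure.support_subset_of_isClosed (h.level_subset_and_isCompact m).2.isClosed (h0 m)
  · rintro _ ⟨s, rfl⟩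
    rw [Measure.mem_support_iff_forall]
    intro U hU
    obtain ⟨δ, hδ, hU⟩ := Metric.mem_nhds_iff.1 hU
    obtain ⟨n, hn⟩ := (h.tendsto_bound.eventually_lt_const hδ).exists
    refine (h1 n s).trans_le (measure_mono (Set.Subset.trans ?_ hU))
    rintro _ ⟨x, hx, rfl⟩
    exact (h.abs_compose_sub_coding_le n s hx).trans_lt hn

theorem range_coding_eq_Icc (h : IsContractingPair g a b τ)
    (hI : g 0 '' Set.Icc a b ∪ g 1 '' Set.Icc a b = Set.Icc a b) :
    Set.range h.coding = Set.Icc a b := by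
  have hl : ∀ m, level g a b m = Set.Icc a b := fun m => by
    induction m with
    | zero => rfl
    | succ m ih => rw [level, ih, hI]
  refine Set.Subset.antisymm (Set.range_subset_iff.2 h.coding_mem) ?_
  simpa only [hl, Set.iInter_const] using h.iInter_level_subset

/-- By the intermediate value theorem the images contain `[g 0 a, b]` and `[a, g 1 b]`, which would
cover `[a, b]` if they overlapped or touched. -/
theorem right_lt_left (h : IsContractingPair g a b τ)
    (hI : g 0 '' Set.Icc a b ∪ g 1 '' Set.Icc a b ⊂ Set.Icc a b) : g 1 b < g 0 a := by
  by_contra! hlt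
  refine hI.2 fun x hx => ?_
  have h0 := intermediate_value_Icc h.le (h.cont 0)
  have h1 := intermediate_value_Icc h.le (h.cont 1)
  rw [h.fix_right] at h0
  rw [h.fix_left] at h1
  rcases le_total x (g 1 b) with hx1 | hx1
  · exact Or.inr (h1 ⟨hx.1, hx1⟩)
  · exact Or.inl (h0 ⟨hlt.trans hx1, hx.2⟩)

/-- With a gap between the two images, a point determines the first letter of its address;
injectivity of that map then determines the point coded by the tail. -/
theorem injective_coding (h : IsContractingPair g a b τ) (hlt : g 1 b < g 0 a) :
    Function.Injective h.coding := by
  have hsep : ∀ x ∈ Set.Icc a b, ∀ y ∈ Set.Icc a b, g 1 x < g 0 y := fun x hx y hy =>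
    ((h.mono 1).monotoneOn hx h.right_mem hx.2).trans_lt
      (hlt.trans_le ((h.mono 0).monotoneOn h.left_mem hy hy.1))
  have head : ∀ s t : ℕ → Fin 2, h.coding s = h.coding t →
      s 0 = t 0 ∧ h.coding (fun k => s (k + 1)) = h.coding (fun k => t (k + 1)) := by
    intro s t hst
    rw [h.coding_eq s, h.coding_eq t] at hst
    have hs := h.coding_mem fun k => s (k + 1)
    have ht := h.coding_mem fun k => t (k + 1)
    have e : s 0 = t 0 := by
      by_contra hne
      have : s 0 = 0 ∧ t 0 = 1 ∨ s 0 = 1 ∧ t 0 = 0 := by omega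
      rcases this with ⟨h1, h2⟩ | ⟨h1, h2⟩ <;> rw [h1, h2] at hst
      · exact (hsep _ ht _ hs).ne' hst
      · exact (hsep _ hs _ ht).ne hst
    refine ⟨e, ?_⟩
    rw [e] at hst
    exact (h.mono (t 0)).injOn hs ht hst
  intro s t hst
  funext n
  induction n generalizing s t with
  | zero => exact (head s t hst).1
  | succ n ih => exact ih (head s t hst).2

theorem isCantorSet_range_coding (h : IsContractingPair g a b τ) (hlt : g 1 b < g 0 a) :
    IsCantorSet (Set.range h.coding) := by
  have e1 : (ℕ → Fin 2) ≃ₜ Set.range h.coding :=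
    (h.continuous_coding.isClosedEmbedding (h.injective_coding hlt)).isEmbedding.toHomeomorph
  have e2 : Fin 2 ≃ₜ Bool := finTwoEquiv.toHomeomorphOfDiscrete
  exact ⟨e1.symm.trans ((Homeomorph.piCongrRight fun _ => e2).trans
    cantorSetHomeomorphNatToBool.symm)⟩

end IsContractingPair

/-! ### Möbius maps: positive fixed points and contraction. -/

section
variable {K a b d e : ℝ}

theorem mobius_fixed_iff (hd : 0 < d) (he : 0 < e) {x : ℝ} (hx : 0 < x) :
    K * ((a * x + b) / (d * x + e)) = x ↔ d * x ^ 2 + (e - K * a) * x - K * b = 0 := by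
  have : 0 < d * x + e := by positivity
  rw [← mul_div_assoc, div_eq_iff this.ne']
  constructor <;> intro h <;> linarith

/-- The quadratic factors as `(x - p) * (d * x + (d * p + e - K * a))`, and the second factor is
positive because `p * (d * p + e - K * a) = K * b`. So its sign at `x` tells on which side of `p`
the point lies. -/
theorem le_of_mobius_fixed (hK : 0 < K) (hb : 0 < b) (hd : 0 < d) {x p : ℝ} (hx : 0 < x)
    (hp : 0 < p) (h : d * p ^ 2 + (e - K * a) * p - K * b = 0)
    (hx' : d * x ^ 2 + (e - K * a) * x - K * b ≤ 0) : x ≤ p := by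
  by_contra! hlt
  have h1 : 0 < K * b := mul_pos hK hb
  have h2 : 0 < p * (d * p + e - K * a) := by linarith
  have h3 : 0 < d * p + e - K * a := pos_of_mul_pos_right h2 hp.le
  have h4 : 0 < (x - p) * (d * x + (d * p + e - K * a)) :=
    mul_pos (sub_pos.2 hlt) (by positivity)
  linarith

theorem ge_of_mobius_fixed (hK : 0 < K) (hb : 0 < b) (hd : 0 < d) {x p : ℝ} (hx : 0 < x)
    (hp : 0 < p) (h : d * p ^ 2 + (e - K * a) * p - K * b = 0)
    (hx' : 0 ≤ d * x ^ 2 + (e - K * a) * x - K * b) : p ≤ x := by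
  by_contra! hlt
  have h1 : 0 < K * b := mul_pos hK hb
  have h2 : 0 < p * (d * p + e - K * a) := by linarith
  have h3 : 0 < d * p + e - K * a := pos_of_mul_pos_right h2 hp.le
  have h4 : 0 < (p - x) * (d * x + (d * p + e - K * a)) :=
    mul_pos (sub_pos.2 hlt) (by positivity)
  linarith

theorem exists_isUniquePosFixedPoint_mobius (hK : 0 < K) (hb : 0 < b) (hd : 0 < d) (he : 0 < e) :
    ∃ p, IsUniquePosFixedPoint (fun x => K * ((a * x + b) / (d * x + e))) p := by
  set D := (e - K * a) ^ 2 + 4 * d * (K * b) with hD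
  have hpos : 0 < 4 * d * (K * b) := by positivity
  have hsq : √D ^ 2 = D := Real.sq_sqrt (by positivity)
  have hlt : e - K * a < √D := by
    refine (le_abs_self _).trans_lt ?_
    rw [← Real.sqrt_sq_eq_abs]
    exact Real.sqrt_lt_sqrt (sq_nonneg _) (by linarith)
  have hp : 0 < (√D - (e - K * a)) / (2 * d) := div_pos (by linarith) (by positivity)
  have hq : d * ((√D - (e - K * a)) / (2 * d)) ^ 2 +
      (e - K * a) * ((√D - (e - K * a)) / (2 * d)) - K * b = 0 := by
    field_simp
    linear_combination hsq
  refine ⟨_, ⟨hp, (mobius_fixed_iff hd he hp).2 hq⟩, fun x hx hfx => ?_⟩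
  have hx' := (mobius_fixed_iff hd he hx).1 hfx
  exact le_antisymm (le_of_mobius_fixed hK hb hd hx hp hq hx'.le)
    (ge_of_mobius_fixed hK hb hd hx hp hq hx'.ge)

theorem mobius_lt (hK : 0 < K) (hd : 0 < d) (he : 0 < e)
    (hdet : 0 < a * e - d * b) {x y : ℝ} (hx : 0 < x) (hxy : x < y) :
    K * ((a * x + b) / (d * x + e)) < K * ((a * y + b) / (d * y + e)) := by
  have hy := hx.trans hxy
  refine mul_lt_mul_of_pos_left ?_ hK
  rw [div_lt_div_iff₀ (by positivity) (by positivity)]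
  have := mul_pos hdet (sub_pos.2 hxy)
  linarith

/-- Raising the denominator from `x` to `y` only helps, so only the numerator's relative growth
counts. There the constant `b` damps it: `a * x / (a * x + b)` increases in `x`, so its value at `p`
bounds it. -/
theorem mobius_sub_le (hK : 0 < K) (ha : 0 < a) (hb : 0 < b) (hd : 0 < d) (he : 0 < e)
    {x y p D : ℝ} (hx : 0 < x) (hxy : x ≤ y) (hyp : y ≤ p) (hD : y - x ≤ D * x) :
    K * ((a * y + b) / (d * y + e)) - K * ((a * x + b) / (d * x + e)) ≤
      a * p / (a * p + b) * D * (K * ((a * x + b) / (d * x + e))) := by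
  have hy := hx.trans_le hxy
  have hp := hy.trans_le hyp
  have hD0 : 0 ≤ D := nonneg_of_mul_nonneg_left ((sub_nonneg.2 hxy).trans hD) hx
  have h1 : a * x ≤ a * p / (a * p + b) * (a * x + b) := by
    rw [div_mul_eq_mul_div, le_div_iff₀ (by positivity)]
    have := mul_le_mul_of_nonneg_left (hxy.trans hyp) (mul_pos ha hb).le
    linarith
  have h2 : (a * y + b) / (d * y + e) ≤ (a * y + b) / (d * x + e) := by gcongr
  have h3 : (a * y + b) / (d * x + e) - (a * x + b) / (d * x + e) ≤
      a * p / (a * p + b) * D * ((a * x + b) / (d * x + e)) := by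
    rw [← sub_div, ← mul_div_assoc]
    gcongr
    have := mul_le_mul_of_nonneg_left hD ha.le
    have := mul_le_mul_of_nonneg_left h1 hD0
    linarith
  calc _ = K * ((a * y + b) / (d * y + e) - (a * x + b) / (d * x + e)) := by ring
    _ ≤ K * (a * p / (a * p + b) * D * ((a * x + b) / (d * x + e))) := by
        gcongr; linarith
    _ = _ := by ring

end

theorem exists_isContractingPair {P : Matrix (Fin 2) (Fin 2) ℝ} {ε : ℝ}
    (hpos : ∀ i j, 0 < P i j) (hrow : ∀ i, ∑ j, P i j = 1) (hdet : 0 < P.det)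
    (hε : 0 < ε) (hε' : ε ≤ 1 / 2) :
    ∃ p₀ p₁ τ, IsUniquePosFixedPoint (f P ε 0) p₀ ∧ IsUniquePosFixedPoint (f P ε 1) p₁ ∧
      P 1 0 / P 0 1 ∈ Set.Icc p₁ p₀ ∧ IsContractingPair (f P ε) p₁ p₀ τ := by
  have h00 := hpos 0 0
  have h01 := hpos 0 1
  have h10 := hpos 1 0
  have h11 := hpos 1 1
  have r0 := hrow 0
  have r1 := hrow 1
  simp only [Fin.sum_univ_two] at r0 r1
  rw [Matrix.det_fin_two] at hdet
  have hK : ∀ i, 0 < noise ε i / noise ε (i + 1) := fun i =>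
    div_pos (noise_pos hε hε' _) (noise_pos hε hε' _)
  have hK0 : 1 ≤ noise ε 0 / noise ε (0 + 1) := by
    rw [le_div_iff₀ (noise_pos hε hε' _)]; simp [noise]; linarith
  have hK1 : noise ε 1 / noise ε (1 + 1) ≤ 1 := by
    rw [div_le_one (noise_pos hε hε' _)]; simp [noise]; linarith
  obtain ⟨p₀, hp₀⟩ := exists_isUniquePosFixedPoint_mobius (a := P 0 0) (hK 0) h10 h01 h11
  obtain ⟨p₁, hp₁⟩ := exists_isUniquePosFixedPoint_mobius (a := P 0 0) (hK 1) h10 h01 h11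
  have q₀ := (mobius_fixed_iff h01 h11 hp₀.1.1).1 hp₀.1.2
  have q₁ := (mobius_fixed_iff h01 h11 hp₁.1.1).1 hp₁.1.2
  have hx0 : 0 < P 1 0 / P 0 1 := by positivity
  -- The starting ratio is the fixed point for `K = 1`. Since the prefactors satisfy `K₁ ≤ 1 ≤ K₀`,
  -- the sign of `1 - K` places it between `p₁` and `p₀`.
  have val : ∀ K : ℝ, P 0 1 * (P 1 0 / P 0 1) ^ 2 + (P 1 1 - K * P 0 0) * (P 1 0 / P 0 1) -
      K * P 1 0 = P 1 0 / P 0 1 * (1 - K) := fun K => by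
    have e0 : P 0 0 = 1 - P 0 1 := by linarith
    have e1 : P 1 1 = 1 - P 1 0 := by linarith
    rw [e0, e1]
    field_simp
    ring
  have m₀ : P 1 0 / P 0 1 ≤ p₀ := le_of_mobius_fixed (hK 0) h10 h01 hx0 hp₀.1.1 q₀ (by
    rw [val]; exact mul_nonpos_of_nonneg_of_nonpos hx0.le (by linarith))
  have m₁ : p₁ ≤ P 1 0 / P 0 1 := ge_of_mobius_fixed (hK 1) h10 h01 hx0 hp₁.1.1 q₁ (by
    rw [val]; exact mul_nonneg hx0.le (by linarith))
  have hp₀' := hp₀.1.1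
  have hmono : ∀ i x y, 0 < x → x < y → f P ε i x < f P ε i y := fun i x y hx hxy =>
    mobius_lt (hK i) h01 h11 (by linarith) hx hxy
  have hle : ∀ x, 0 < x → f P ε 1 x ≤ f P ε 0 x := fun x hx =>
    mul_le_mul_of_nonneg_right (hK1.trans hK0) (by positivity)
  have hmono' : ∀ i x y, 0 < x → x ≤ y → f P ε i x ≤ f P ε i y := fun i x y hx hxy =>
    hxy.eq_or_lt.elim (fun h => h ▸ le_rfl) fun h => (hmono i x y hx h).le
  refine ⟨p₀, p₁, P 0 0 * p₀ / (P 0 0 * p₀ + P 1 0), hp₀, hp₁, ⟨m₁, m₀⟩, hp₁.1.1, m₁.trans m₀,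
    fun i x hx => ?_, fun i x hx y hy hxy => hmono i x y (hp₁.1.1.trans_le hx.1) hxy,
    fun i x hx => ?_, hp₀.1.2, hp₁.1.2, by positivity, ?_, fun i D x y hx hy hxy hD =>
    mobius_sub_le (hK i) h00 h10 h01 h11 (hp₁.1.1.trans_le hx.1) hxy hy.2 hD⟩
  · have hx0 := hp₁.1.1.trans_le hx.1
    have : P 0 1 * x + P 1 1 ≠ 0 := by positivity
    refine ContinuousAt.continuousWithinAt ?_
    unfold f
    fun_prop (disch := assumption)
  · have hx0 := hp₁.1.1.trans_le hx.1
    -- Invariance follows from the chain `p₁ = f 1 p₁ ≤ f 1 x ≤ f 0 x ≤ f 0 p₀ = p₀`.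
    have l1 : p₁ ≤ f P ε 1 x := hp₁.1.2.symm.le.trans (hmono' 1 p₁ x hp₁.1.1 hx.1)
    have l2 : f P ε 0 x ≤ p₀ := (hmono' 0 x p₀ hx0 hx.2).trans hp₀.1.2.le
    have l3 := hle x hx0
    rcases Fin.exists_fin_two.1 ⟨i, rfl⟩ with rfl | rfl
    exacts [⟨l1.trans l3, l2⟩, ⟨l1, l3.trans l2⟩]
  · rw [div_lt_one (by positivity)]
    linarith

/-! ### Weak convergence of the laws of the ratio. -/

/-- A sequence of probability measures carried by a common compact set, along which the integrals
of all bounded Lipschitz functions are Cauchy, converges weakly. -/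
theorem exists_tendsto_of_cauchySeq_integral {X : Type*} [PseudoMetricSpace X] [T2Space X]
    [MeasurableSpace X] [BorelSpace X] {μ : ℕ → ProbabilityMeasure X} {K : Set X}
    (hK : IsCompact K) (hμ : ∀ n, (μ n : Measure X) Kᶜ = 0)
    (hc : ∀ F : X → ℝ, (∃ C : ℝ, ∀ x y, dist (F x) (F y) ≤ C) → (∃ L, LipschitzWith L F) →
      CauchySeq fun n => ∫ x, F x ∂(μ n : Measure X)) :
    ∃ Q, Tendsto μ atTop (𝓝 Q) := by
  have ht : IsTightMeasureSet {((ν : ProbabilityMeasure X) : Measure X) | ν ∈ Set.range μ} := by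
    rw [isTightMeasureSet_iff_exists_isCompact_measure_compl_le]
    intro δ _
    refine ⟨K, hK, ?_⟩
    rintro _ ⟨_, ⟨n, rfl⟩, rfl⟩
    rw [hμ]
    exact zero_le
  -- Tightness yields a limit along a free ultrafilter; the Cauchy hypothesis then upgrades it to a
  -- limit along `atTop`, since both limits of each integral must agree.
  obtain ⟨Q, -, hQ⟩ := (isCompact_closure_of_isTightMeasureSet ht).ultrafilter_le_nhds
    ((hyperfilter ℕ).map μ) (le_principal_iff.2 (mem_map.2 (Eventually.of_forall fun n =>
      subset_closure ⟨n, rfl⟩)))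
  refine ⟨Q, tendsto_iff_forall_lipschitz_integral_tendsto.2 fun F hb hL => ?_⟩
  obtain ⟨l, hl⟩ := cauchySeq_tendsto_of_complete (hc F hb hL)
  obtain ⟨C, hC⟩ := hb
  obtain ⟨L, hL⟩ := hL
  have h1 : Tendsto (fun n => ∫ x, F x ∂(μ n : Measure X)) (hyperfilter ℕ : Filter ℕ)
      (𝓝 (∫ x, F x ∂(Q : Measure X))) :=
    ProbabilityMeasure.tendsto_iff_forall_integral_tendsto.1 hQ
      (BoundedContinuousFunction.mkOfBound ⟨F, hL.continuous⟩ C hC)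
  have h2 := hl.mono_left Nat.hyperfilter_le_atTop
  rwa [tendsto_nhds_unique h1 h2]

theorem coe_ratioLaw (P : Matrix (Fin 2) (Fin 2) ℝ) (ε : ℝ) (n : ℕ) :
    (ratioLaw P ε n : Measure ℝ) =
      ∑ z, ENNReal.ofReal (wordProb P ε n z) • Measure.dirac (ratio P ε n z) := by
  rw [ratioLaw, FiniteMeasure.toMeasure_sum]
  rfl

theorem ratioLaw_apply (P : Matrix (Fin 2) (Fin 2) ℝ) (ε : ℝ) (n : ℕ) (S : Set ℝ) :
    (ratioLaw P ε n : Measure ℝ) S =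
      ∑ z, ENNReal.ofReal (wordProb P ε n z) * S.indicator 1 (ratio P ε n z) := by
  simp [coe_ratioLaw, Measure.dirac_apply]

section

variable {P : Matrix (Fin 2) (Fin 2) ℝ} {ε : ℝ}

theorem isProbabilityMeasure_ratioLaw (hpos : ∀ i j, 0 < P i j) (hrow : ∀ i, ∑ j, P i j = 1)
    (hε : 0 < ε) (hε' : ε ≤ 1 / 2) (n : ℕ) :
    IsProbabilityMeasure (ratioLaw P ε n : Measure ℝ) := by
  constructor
  rw [ratioLaw_apply]
  simp only [Set.indicator_univ, Pi.one_apply, mul_one]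
  rw [← ENNReal.ofReal_sum_of_nonneg fun z _ => (wordProb_pos hpos hε hε' n z).le,
    sum_wordProb hpos hrow, ENNReal.ofReal_one]

theorem integral_ratioLaw (hpos : ∀ i j, 0 < P i j) (hε : 0 < ε) (hε' : ε ≤ 1 / 2) (n : ℕ)
    (F : ℝ → ℝ) :
    ∫ x, F x ∂(ratioLaw P ε n : Measure ℝ) = ∑ z, wordProb P ε n z * F (ratio P ε n z) := by
  rw [coe_ratioLaw, integral_finsetSum_measure]
  · refine Finset.sum_congr rfl fun z _ => ?_
    rw [integral_smul_measure, integral_dirac, ENNReal.toReal_ofReal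
      (wordProb_pos hpos hε hε' n z).le, smul_eq_mul]
  · intro z _
    exact (integrable_dirac (by simp)).smul_measure ENNReal.ofReal_ne_top

theorem ratioLaw_compl_eq_zero {n : ℕ} {S : Set ℝ} (hS : ∀ z, ratio P ε n z ∈ S) :
    (ratioLaw P ε n : Measure ℝ) Sᶜ = 0 := by
  rw [ratioLaw_apply]
  simp [hS]

theorem ofReal_mul_ratioLaw_le (hpos : ∀ i j, 0 < P i j) (hrow : ∀ i, ∑ j, P i j = 1)
    (hε : 0 < ε) (hε' : ε ≤ 1 / 2) (n : ℕ) (a : Fin 2) {S T : Set ℝ}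
    (hST : Set.MapsTo (f P ε a) S T) :
    ENNReal.ofReal ε * (ratioLaw P ε n : Measure ℝ) S ≤
      (ratioLaw P ε (n + 1) : Measure ℝ) T := by
  rw [ratioLaw_apply, ratioLaw_apply, sum_snoc, Finset.mul_sum]
  refine le_trans ?_ (Finset.single_le_sum (fun i _ => bot_le) (Finset.mem_univ a))
  refine Finset.sum_le_sum fun z _ => ?_
  rw [← mul_assoc, ← ENNReal.ofReal_mul hε.le, ratio_snoc hpos hε hε']
  refine mul_le_mul' (ENNReal.ofReal_le_ofReal (mul_wordProb_le hpos hrow hε hε' n z a)) ?_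
  by_cases hx : ratio P ε n z ∈ S
  · simp [hx, hST hx]
  · simp [hx]

theorem ratio_succ (hpos : ∀ i j, 0 < P i j) (hε : 0 < ε) (hε' : ε ≤ 1 / 2) {n : ℕ}
    (z : Fin (n + 1) → Fin 2) :
    ratio P ε (n + 1) z = f P ε (z (Fin.last n)) (ratio P ε n (Fin.init z)) := by
  rw [← ratio_snoc hpos hε hε', Fin.snoc_init_self]

variable {a b τ : ℝ}

/-- The last `m` letters apply `m` maps to an earlier ratio, which already lies in `[a, b]`. -/
theorem ratio_mem_level (h : IsContractingPair (f P ε) a b τ) (hx : P 1 0 / P 0 1 ∈ Set.Icc a b)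
    (hpos : ∀ i j, 0 < P i j) (hε : 0 < ε) (hε' : ε ≤ 1 / 2) {m n : ℕ} (hmn : m ≤ n)
    (z : Fin n → Fin 2) : ratio P ε n z ∈ level (f P ε) a b m := by
  induction m generalizing n with
  | zero =>
    clear hmn
    induction n with
    | zero => rwa [ratio_zero hpos]
    | succ n ih => rw [ratio_succ hpos hε hε']; exact h.maps _ (ih _)
  | succ m ih =>
    obtain ⟨n, rfl⟩ := Nat.exists_eq_succ_of_ne_zero (Nat.ne_zero_of_lt hmn)
    rw [ratio_succ hpos hε hε']
    have := ih (Nat.le_of_succ_le_succ hmn) (Fin.init z)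
    rcases Fin.exists_fin_two.1 ⟨z (Fin.last n), rfl⟩ with h1 | h1 <;> rw [h1]
    exacts [Or.inl ⟨_, this, rfl⟩, Or.inr ⟨_, this, rfl⟩]

theorem ratio_mem (h : IsContractingPair (f P ε) a b τ) (hx : P 1 0 / P 0 1 ∈ Set.Icc a b)
    (hpos : ∀ i j, 0 < P i j) (hε : 0 < ε) (hε' : ε ≤ 1 / 2) (n : ℕ)
    (z : Fin n → Fin 2) : ratio P ε n z ∈ Set.Icc a b :=
  ratio_mem_level h hx hpos hε hε' n.zero_le z

/-- The first letter of a long word has little influence on the ratio. -/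
theorem abs_ratio_cons_sub_le (h : IsContractingPair (f P ε) a b τ)
    (hx : P 1 0 / P 0 1 ∈ Set.Icc a b) (hpos : ∀ i j, 0 < P i j) (hε : 0 < ε) (hε' : ε ≤ 1 / 2)
    (n : ℕ) (z : Fin n → Fin 2) (i : Fin 2) :
    |ratio P ε (n + 1) (Fin.cons i z) - ratio P ε n z| ≤ (b - a) / a * b * τ ^ n := by
  have hmem := ratio_mem h hx hpos hε hε'
  -- Which ratio is larger is settled by the initial values; the common later letters act by
  -- increasing maps and preserve it.
  have key : (ratio P ε (n + 1) (Fin.cons i z) ≤ ratio P ε n z ∧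
      ratio P ε n z - ratio P ε (n + 1) (Fin.cons i z) ≤
        τ ^ n * ((b - a) / a) * ratio P ε (n + 1) (Fin.cons i z)) ∨
      (ratio P ε n z ≤ ratio P ε (n + 1) (Fin.cons i z) ∧
      ratio P ε (n + 1) (Fin.cons i z) - ratio P ε n z ≤
        τ ^ n * ((b - a) / a) * ratio P ε n z) := by
    induction n with
    | zero =>
      simp only [pow_zero, one_mul]
      rcases le_total (ratio P ε 1 (Fin.cons i z)) (ratio P ε 0 z) with hle | hle
      · exact Or.inl ⟨hle, h.sub_le (hmem _ _) (hmem _ _)⟩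
      · exact Or.inr ⟨hle, h.sub_le (hmem _ _) (hmem _ _)⟩
    | succ n ih =>
      rw [ratio_succ hpos hε hε' (Fin.cons i z), ratio_succ hpos hε hε' z, last_cons, init_cons,
        pow_succ', mul_assoc τ]
      rcases ih (Fin.init z) with ⟨h1, h2⟩ | ⟨h1, h2⟩
      · exact Or.inl ⟨(h.mono _).monotoneOn (hmem _ _) (hmem _ _) h1,
          h.contr _ _ _ _ (hmem _ _) (hmem _ _) h1 h2⟩
      · exact Or.inr ⟨(h.mono _).monotoneOn (hmem _ _) (hmem _ _) h1,
          h.contr _ _ _ _ (hmem _ _) (hmem _ _) h1 h2⟩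
  rcases key with ⟨h1, h2⟩ | ⟨h1, h2⟩
  · rw [abs_sub_comm]
    exact h.dist_le_of_le n (hmem _ _) h1 h2
  · exact h.dist_le_of_le n (hmem _ _) h1 h2

theorem cauchySeq_integral_ratioLaw (h : IsContractingPair (f P ε) a b τ)
    (hx : P 1 0 / P 0 1 ∈ Set.Icc a b) (hpos : ∀ i j, 0 < P i j) (hrow : ∀ i, ∑ j, P i j = 1)
    (hε : 0 < ε) (hε' : ε ≤ 1 / 2) {F : ℝ → ℝ} {L : ℝ≥0} (hF : LipschitzWith L F) :
    CauchySeq fun n => ∫ x, F x ∂(ratioLaw P ε n : Measure ℝ) := by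
  refine cauchySeq_of_le_geometric τ (L * ((b - a) / a * b)) h.lt_one fun n => ?_
  rw [integral_ratioLaw hpos hε hε', integral_ratioLaw hpos hε hε', dist_comm, Real.dist_eq,
    sum_cons, Finset.sum_comm]
  -- Stationarity rewrites the weights of words of length `n` over words of length `n + 1`, so both
  -- integrals carry the same weights and only the values of `F` are compared.
  simp_rw [← sum_wordProb_cons (ε := ε) hpos hrow n, Finset.sum_mul]
  simp_rw [← Finset.sum_sub_distrib, ← mul_sub]
  have hw := wordProb_pos (P := P) hpos hε hε' (n + 1)
  calc _ ≤ ∑ z : Fin n → Fin 2, ∑ i : Fin 2, wordProb P ε (n + 1) (Fin.cons i z) *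
        (L * ((b - a) / a * b * τ ^ n)) := by
        refine (Finset.abs_sum_le_sum_abs _ _).trans (Finset.sum_le_sum fun z _ =>
          (Finset.abs_sum_le_sum_abs _ _).trans (Finset.sum_le_sum fun i _ => ?_))
        rw [abs_mul, abs_of_pos (hw _)]
        refine mul_le_mul_of_nonneg_left ?_ (hw _).le
        refine (hF.dist_le_mul _ _).trans ?_
        gcongr
        exact abs_ratio_cons_sub_le h hx hpos hε hε' n z i
    _ = L * ((b - a) / a * b) * τ ^ n := by
        simp_rw [← Finset.sum_mul, sum_wordProb_cons hpos hrow, sum_wordProb hpos hrow]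
        ring

/-- Composition order reverses time: `s 0` is the last letter observed. The bound does not depend on
the number `N` of earlier letters, so it survives the limit. -/
theorem pow_le_ratioLaw_compose (h : IsContractingPair (f P ε) a b τ)
    (hx : P 1 0 / P 0 1 ∈ Set.Icc a b) (hpos : ∀ i j, 0 < P i j) (hrow : ∀ i, ∑ j, P i j = 1)
    (hε : 0 < ε) (hε' : ε ≤ 1 / 2) (N n : ℕ) (s : ℕ → Fin 2) :
    ENNReal.ofReal ε ^ n ≤
      (ratioLaw P ε (N + n) : Measure ℝ) (compose (f P ε) n s '' Set.Icc a b) := by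
  induction n generalizing s with
  | zero =>
    have := isProbabilityMeasure_ratioLaw hpos hrow hε hε' N
    have e : compose (f P ε) 0 s '' Set.Icc a b = Set.Icc a b := Set.image_id _
    rw [pow_zero, e, add_zero, (prob_compl_eq_zero_iff measurableSet_Icc).1
      (ratioLaw_compl_eq_zero (ratio_mem h hx hpos hε hε' N))]
  | succ n ih =>
    rw [pow_succ']
    refine (mul_le_mul_right (ih fun k => s (k + 1)) _).trans
      (ofReal_mul_ratioLaw_le hpos hrow hε hε' (N + n) (s 0) ?_)
    rintro _ ⟨x, hx, rfl⟩
    exact ⟨x, hx, rfl⟩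

end

/-- Portmanteau: closed sets cannot lose mass in the limit. It serves both for the full mass of
levels and for the lower bounds on cylinders. -/
theorem le_measure_of_tendsto {X : Type*} [PseudoMetricSpace X] [MeasurableSpace X] [BorelSpace X]
    {μ : ℕ → ProbabilityMeasure X} {Q : ProbabilityMeasure X} (hQ : Tendsto μ atTop (𝓝 Q))
    {S : Set X} (hS : IsClosed S) {c : ENNReal} (hc : ∀ᶠ n in atTop, c ≤ (μ n : Measure X) S) :
    c ≤ (Q : Measure X) S :=
  (le_limsup_of_frequently_le' hc.frequently).trans
    (ProbabilityMeasure.limsup_measure_closed_le_of_tendsto hQ hS)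

/-- The weak limit of the laws of the ratio exists, and its support is the attractor. -/
theorem exists_tendsto_ratioLaw {P : Matrix (Fin 2) (Fin 2) ℝ} {ε a b τ : ℝ}
    (h : IsContractingPair (f P ε) a b τ)
    (hx : P 1 0 / P 0 1 ∈ Set.Icc a b) (hpos : ∀ i j, 0 < P i j) (hrow : ∀ i, ∑ j, P i j = 1)
    (hε : 0 < ε) (hε' : ε ≤ 1 / 2) :
    ∃ Q : ProbabilityMeasure ℝ, Tendsto (fun n => ratioLaw P ε n) atTop (𝓝 Q.toFiniteMeasure) ∧
      (Q : Measure ℝ).support = Set.range h.coding := by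
  let μ : ℕ → ProbabilityMeasure ℝ := fun n =>
    ⟨ratioLaw P ε n, isProbabilityMeasure_ratioLaw hpos hrow hε hε' n⟩
  obtain ⟨Q, hQ⟩ := exists_tendsto_of_cauchySeq_integral (μ := μ) isCompact_Icc
    (fun n => ratioLaw_compl_eq_zero (ratio_mem h hx hpos hε hε' n))
    fun F _ ⟨L, hL⟩ => cauchySeq_integral_ratioLaw h hx hpos hrow hε hε' hL
  refine ⟨Q, (ProbabilityMeasure.tendsto_nhds_iff_toFiniteMeasure_tendsto_nhds _).1 hQ,
    h.support_eq_range _ (fun m => ?_) fun n s => ?_⟩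
  · have hcl := (h.level_subset_and_isCompact m).2.isClosed
    rw [prob_compl_eq_zero_iff hcl.measurableSet]
    refine le_antisymm prob_le_one (le_measure_of_tendsto hQ hcl ?_)
    filter_upwards [eventually_ge_atTop m] with n hn
    refine ((prob_compl_eq_zero_iff (μ := (μ n : Measure ℝ)) hcl.measurableSet).1 ?_).ge
    exact ratioLaw_compl_eq_zero (ratio_mem_level h hx hpos hε hε' hn)
  · refine (ENNReal.pow_pos (ENNReal.ofReal_pos.2 hε) n).trans_le (le_measure_of_tendsto hQ
      (isCompact_Icc.image_of_continuousOn (h.continuousOn_compose n s)).isClosed ?_)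
    filter_upwards [eventually_ge_atTop n] with N hN
    obtain ⟨N, rfl⟩ := Nat.exists_eq_add_of_le' hN
    exact pow_le_ratioLaw_compose h hx hpos hrow hε hε' N n s

end NoisyMarkov

theorem mainTheorem5 (P : Matrix (Fin 2) (Fin 2) ℝ) (ε : ℝ)
    (hpos : ∀ i j, 0 < P i j) (hrow : ∀ i, ∑ j, P i j = 1) (hdet : 0 < P.det)
    (hε : 0 < ε) (hε' : ε ≤ 1 / 2) :
    ∃ (Q : ProbabilityMeasure ℝ) (p₀ p₁ : ℝ),
      Tendsto (fun n : ℕ => NoisyMarkov.ratioLaw P ε n) atTop (𝓝 Q.toFiniteMeasure) ∧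
      NoisyMarkov.IsUniquePosFixedPoint (NoisyMarkov.f P ε 0) p₀ ∧
      NoisyMarkov.IsUniquePosFixedPoint (NoisyMarkov.f P ε 1) p₁ ∧
      p₁ ≤ p₀ ∧
      (NoisyMarkov.IsCantorSet (Q : Measure ℝ).support ∨
        ∃ a b : ℝ, a ≤ b ∧ (Q : Measure ℝ).support = Set.Icc a b) ∧
      (NoisyMarkov.f P ε 0 '' Set.Icc p₁ p₀ ∪ NoisyMarkov.f P ε 1 '' Set.Icc p₁ p₀
          ⊂ Set.Icc p₁ p₀ →
        NoisyMarkov.IsCantorSet (Q : Measure ℝ).support) ∧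
      (NoisyMarkov.f P ε 0 '' Set.Icc p₁ p₀ ∪ NoisyMarkov.f P ε 1 '' Set.Icc p₁ p₀
          = Set.Icc p₁ p₀ →
        (Q : Measure ℝ).support = Set.Icc p₁ p₀) := by
  obtain ⟨p₀, p₁, τ, h₀, h₁, hx, h⟩ :=
    NoisyMarkov.exists_isContractingPair hpos hrow hdet hε hε'
  obtain ⟨Q, hQ, hsupp⟩ := NoisyMarkov.exists_tendsto_ratioLaw h hx hpos hrow hε hε'
  have hsub : NoisyMarkov.f P ε 0 '' Set.Icc p₁ p₀ ∪ NoisyMarkov.f P ε 1 '' Set.Icc p₁ p₀ ⊆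
      Set.Icc p₁ p₀ := Set.union_subset (h.maps 0).image_subset (h.maps 1).image_subset
  have hC : NoisyMarkov.f P ε 0 '' Set.Icc p₁ p₀ ∪ NoisyMarkov.f P ε 1 '' Set.Icc p₁ p₀ ⊂
      Set.Icc p₁ p₀ → NoisyMarkov.IsCantorSet (Q : Measure ℝ).support := fun hI => by
    rw [hsupp]
    exact h.isCantorSet_range_coding (h.right_lt_left hI)
  have hE : NoisyMarkov.f P ε 0 '' Set.Icc p₁ p₀ ∪ NoisyMarkov.f P ε 1 '' Set.Icc p₁ p₀ =
      Set.Icc p₁ p₀ → (Q : Measure ℝ).support = Set.Icc p₁ p₀ := fun hI =>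
    hsupp.trans (h.range_coding_eq_Icc hI)
  -- The interval is invariant, so the union of images is either all of it or a proper subset: the
  -- two cases are exhaustive.
  exact ⟨Q, p₀, p₁, hQ, h₀, h₁, h.le, hsub.eq_or_ssubset.elim
    (fun hI => Or.inr ⟨p₁, p₀, h.le, hE hI⟩) (fun hI => Or.inl (hC hI)), hC, hE⟩
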